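/- For $0<a<1$ let $K_a$ be the tempered distribution on $\mathbb R$ with Fourier transform $\widehat{K_a}(\xi)=\left(\frac{\tanh \xi}{\xi}\right)^{a}$ (value $1$ at $\xi=0$), where $\hat f(\xi)=\int_{\mathbb R} f(x)e^{-ix\xi}\,\mathrm{d}x$; for $f\in L^2(\mathbb R)$ the convolution $K_a*f\in L^2(\mathbb R)$ is given by $\widehat{K_a*f}=\widehat{K_a}\,\hat f$. For $\alpha>0$ let $\Psi_\alpha:\mathbb R\to[0,\infty)$ be the even function with $$\Psi_\alpha(y)=\begin{cases}\alpha y^2-\frac13 y^3, & 0\le y<\alpha,\\ \frac23\alpha^3+\alpha^2(y-\alpha)+(y-\alpha)^3, & y\ge\alpha,\end{cases}$$ let $\mathcal L^{\Psi_\alpha}$ be the space of measurable $f:\mathbb R\to\mathbb R$ with $\int_{\mathbb R}\Psi_\alpha(cf(x))\,\mathrm{d}x<\infty$ for some $c>0$ (it is contained in $L^2(\mathbb R)$), with the gauge norm $N_{\Psi_\alpha}(f)=\inf\{\lambda>0:\int_{\mathbb R}\Psi_\alpha(f(x)/\lambda)\,\mathrm{d}x\le 1\}$, and let $$J_\alpha=\sup\left\{\|K_{1/4}*f\|_{L^2(\mathbb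 R)} : f\in\mathcal L^{\Psi_\alpha},\ N_{\Psi_\alpha}(f)=1\right\}.$$ Then the map $\alpha\mapsto \alpha J_\alpha^2$ is continuous and strictly decreasing on $(0,\infty)$, and $$\lim_{\alpha\to\infty}\alpha J_\alpha^2=1,\qquad \lim_{\alpha\searrow 0}\alpha J_\alpha^2=\frac{3\tilde B^2}{2+3(\tilde B-1)+3(\tilde B-1)^3}>\frac32,$$ where $\tilde B=\frac{4}{\sqrt3}\cos\left(\frac{5\pi}{18}\right)\approx 1.48$ (precisely, $|\tilde B-1.48|<0.005$). -/

import Mathlib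

open MeasureTheory Filter Topology Set FourierTransform
open scoped ENNReal

namespace Whitham

noncomputable section

/-! ### The kernels `K_a` and the operators `f ↦ K_a * f` -/

/-- The symbol `(tanh ξ / ξ) ^ a` of the kernel `K_a`, extended continuously by `1` to `ξ = 0`.
The frequency variable `ξ` belongs to the convention `f̂(ξ) = ∫ f(x) e^{-i x ξ} dx`. -/
def symbol (a ξ : ℝ) : ℝ :=
  if ξ = 0 then 1 else (Real.tanh ξ / ξ) ^ a

theorem tanh_le_self {x : ℝ} (hx : 0 ≤ x) : Real.tanh x ≤ x := by
  have hmono : MonotoneOn (fun y : ℝ => y * Real.cosh y - Real.sinh y) (Ici 0) := by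
    have hd : ∀ y : ℝ, HasDerivAt (fun y : ℝ => y * Real.cosh y - Real.sinh y)
        (1 * Real.cosh y + y * Real.sinh y - Real.cosh y) y := fun y =>
      ((hasDerivAt_id y).mul (Real.hasDerivAt_cosh y)).sub (Real.hasDerivAt_sinh y)
    refine monotoneOn_of_deriv_nonneg (convex_Ici 0)
      (fun y _ => (hd y).continuousAt.continuousWithinAt)
      (fun y _ => (hd y).differentiableAt.differentiableWithinAt) (fun y hy => ?_)
    rw [interior_Ici] at hy
    rw [(hd y).deriv]
    have h1 : 0 ≤ Real.sinh y := Real.sinh_nonneg_iff.2 (le_of_lt hy)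
    have h2 : 0 ≤ y * Real.sinh y := mul_nonneg (le_of_lt hy) h1
    linarith
  have h := hmono (mem_Ici.2 le_rfl) hx hx
  simp only [Real.sinh_zero, zero_mul, sub_zero] at h
  rw [Real.tanh_eq_sinh_div_cosh, div_le_iff₀ (Real.cosh_pos x)]
  linarith

theorem tanh_div_self_mem (ξ : ℝ) : Real.tanh ξ / ξ ∈ Icc (0 : ℝ) 1 := by
  have key : ∀ x : ℝ, 0 ≤ x → Real.tanh x / x ∈ Icc (0 : ℝ) 1 := by
    intro x hx
    have h0 : 0 ≤ Real.tanh x := by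
      rw [Real.tanh_eq_sinh_div_cosh]
      exact div_nonneg (Real.sinh_nonneg_iff.2 hx) (Real.cosh_pos x).le
    exact ⟨div_nonneg h0 hx, div_le_one_of_le₀ (tanh_le_self hx) hx⟩
  rcases le_total 0 ξ with h | h
  · exact key ξ h
  · have := key (-ξ) (by linarith)
    rwa [Real.tanh_neg, neg_div_neg_eq] at this

theorem symbol_mem {a : ℝ} (ha : 0 ≤ a) (ξ : ℝ) : symbol a ξ ∈ Icc (0 : ℝ) 1 := by
  unfold symbol
  split_ifs
  · simp
  · have h := tanh_div_self_mem ξ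
    exact ⟨Real.rpow_nonneg h.1 a, Real.rpow_le_one h.1 h.2 ha⟩

theorem measurable_symbol (a : ℝ) : Measurable (symbol a) := by
  have ht : Measurable Real.tanh := by
    have : Real.tanh = fun x => Real.sinh x / Real.cosh x :=
      funext Real.tanh_eq_sinh_div_cosh
    rw [this]
    exact Real.measurable_sinh.div Real.measurable_cosh
  exact Measurable.ite (measurableSet_singleton (0 : ℝ)) measurable_const
    ((ht.div measurable_id).pow_const a)

/-- Mathlib's Fourier transform is `𝓕 f ν = ∫ f(x) e^{-2 π i x ν} dx`, so that the frequency `ξ`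
above is `2 π ν`. -/
theorem memLp_symbol {a : ℝ} (ha : 0 ≤ a) :
    MemLp (fun ν : ℝ => (symbol a (2 * Real.pi * ν) : ℂ)) ∞ (volume : Measure ℝ) := by
  refine memLp_top_of_bound
    (Complex.measurable_ofReal.comp
      ((measurable_symbol a).comp (measurable_const_mul _))).aestronglyMeasurable 1
    (Eventually.of_forall fun ν => ?_)
  have h := symbol_mem ha (2 * Real.pi * ν)
  rw [Complex.norm_real, Real.norm_of_nonneg h.1]
  exact h.2

/-- Convolution with `K_a` on `L²(ℝ)`. The kernel `K_a` is the tempered distribution whose Fourier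
transform is `(tanh ξ / ξ) ^ a`, and `K_a * f` is the element of `L²` with
`𝓕 (K_a * f) (ξ) = (tanh ξ / ξ) ^ a · 𝓕 f (ξ)`, for the Fourier transform on `L²`. -/
def convK (a : ℝ) (ha : 0 ≤ a) (f : Lp ℂ 2 (volume : Measure ℝ)) :
    Lp ℂ 2 (volume : Measure ℝ) :=
  𝓕⁻ (((memLp_symbol ha).toLp _ • 𝓕 f : Lp ℂ 2 (volume : Measure ℝ)))

/-! ### The Orlicz space -/

/-- The Orlicz function `Ψ` with parameter `α > 0`, extended evenly to `ℝ`. -/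
def Psi (α y : ℝ) : ℝ :=
  if |y| < α then α * |y| ^ 2 - |y| ^ 3 / 3
  else 2 / 3 * α ^ 3 + α ^ 2 * (|y| - α) + (|y| - α) ^ 3

/-- Membership in the Orlicz space `𝓛^Ψ` over `ℝ` with Lebesgue measure. -/
def MemOrlicz (Ψ : ℝ → ℝ) (f : ℝ → ℝ) : Prop :=
  AEStronglyMeasurable f volume ∧
    ∃ c : ℝ, 0 < c ∧ ∫⁻ x, ENNReal.ofReal (Ψ (c * f x)) < ∞

/-- The gauge norm `N_Ψ(f) = inf {λ > 0 : ∫ Ψ(f / λ) ≤ 1}`. -/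
def gaugeNorm (Ψ : ℝ → ℝ) (f : ℝ → ℝ) : ℝ :=
  sInf {l : ℝ | 0 < l ∧ ∫⁻ x, ENNReal.ofReal (Ψ (f x / l)) ≤ 1}

theorem Psi_ge {α : ℝ} (hα : 0 < α) (y : ℝ) : α / 3 * y ^ 2 ≤ Psi α y := by
  rw [← sq_abs y]
  have hz := abs_nonneg y
  unfold Psi
  generalize |y| = z at hz ⊢
  split_ifs with h
  · nlinarith [mul_nonneg (sq_nonneg z) (sub_nonneg.2 h.le), mul_nonneg hα.le (sq_nonneg z)]
  · obtain ⟨t, ht, rfl⟩ : ∃ t, 0 ≤ t ∧ z = α + t := ⟨z - α, by linarith, by ring⟩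
    have h3 : 0 ≤ t * (t - α / 6) ^ 2 := mul_nonneg ht (sq_nonneg _)
    have h4 : 0 ≤ t * α ^ 2 := mul_nonneg ht (sq_nonneg _)
    have h5 : 0 ≤ α ^ 3 := by positivity
    nlinarith

/-- The Orlicz space is contained in `L²`, so that `K_a * f` makes sense on all of it. -/
theorem MemOrlicz.memLp_two {α : ℝ} (hα : 0 < α) {f : ℝ → ℝ} (hf : MemOrlicz (Psi α) f) :
    MemLp f 2 volume := by
  obtain ⟨hm, c, hc, hfin⟩ := hf
  rw [memLp_two_iff_integrable_sq hm]
  have hint : Integrable (fun x => α / 3 * (c * f x) ^ 2) volume := by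
    refine ⟨((hm.const_mul c).pow 2).const_mul (α / 3), ?_⟩
    rw [hasFiniteIntegral_iff_ofReal (Eventually.of_forall fun x => by positivity)]
    exact (lintegral_mono fun x => ENNReal.ofReal_le_ofReal (Psi_ge hα _)).trans_lt hfin
  have h2 := hint.const_mul (α / 3 * c ^ 2)⁻¹
  refine h2.congr (Eventually.of_forall fun x => ?_)
  simp only
  field_simp

/-! ### The variational problem -/

/-- `J_α = sup {‖K_{1/4} * f‖_{L²} : f ∈ 𝓛^Ψ, N_Ψ(f) = 1}`, over real-valued `f`. For `α > 0` the
hypothesis `f ∈ L²` is no restriction (`MemOrlicz.memLp_two`); it only allows one to regard `f` as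
an element of the Hilbert space `L²`. -/
def J (α : ℝ) : ℝ :=
  sSup {r : ℝ | ∃ (f : ℝ → ℝ) (hf : MemLp f 2 (volume : Measure ℝ)),
    MemOrlicz (Psi α) f ∧ gaugeNorm (Psi α) f = 1 ∧
      r = ‖convK (1 / 4) (by norm_num) ((hf.ofReal (K := ℂ)).toLp _)‖}

/-- The number `B̃ = (4 / √3) cos (5 π / 18)`. -/
def B : ℝ := 4 / √3 * Real.cos (5 * Real.pi / 18)

end

end Whitham

/-! Since `Psi α (α * y) = α ^ 3 * Psi 1 y`, writing f = α g turns the problem into M(s) = sup of ∫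
ker |ĝ|² over integrable g with ∫ Psi 1 g ≤ s, where s = α⁻³, and α J_α² = M(s)/s (`J_eq`,
`mul_J_sq`). It remains to study M(s)/s for s > 0.

Dilating g by t > 1 multiplies the constraint by t, and the form by t after replacing ker(ν) by
ker(ν/t). As ker(ν) ≤ ker(ν/t) ≤ √t ker(ν), the ratio is nondecreasing and grows at most like √t,
hence is continuous. For strictness (`mul_maxQf_lt`), the gain ker(ν/t)/ker(ν) is uniform away from
ν = 0, while low frequencies alone give barely more than s. Because M(s) > s, near-maximizers keep a
fixed share of high frequencies, so no maximizer is needed.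

As s → 0, small values of g see an almost quadratic `Psi 1` and contribute about s at most; large
values have L¹ norm O(s), and the decay of ker makes their contribution o(s) (`Adm.sqrt_qf_le`). As
s → ∞, long plateaus of height B lose only a bounded amount to the symbol (`le_qf_ker_indicator`),
so the limit is the pointwise maximum of y²/Psi 1 y, attained at B. -/

namespace Whitham

noncomputable section

/-! ### Plancherel's identity and convolution with K_a -/

/-- On `L¹ ∩ L²` the Fourier transform of `L²` is given by the Fourier integral. -/
theorem fourier_toLp_ae_eq {f : ℝ → ℂ} (h1 : Integrable f) (h2 : MemLp f 2 volume) :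
    (𝓕 (h2.toLp f) : Lp ℂ 2 (volume : Measure ℝ)) =ᵐ[volume] 𝓕 f := by
  have hcont : Continuous (𝓕 f) :=
    VectorFourier.fourierIntegral_continuous Real.continuous_fourierChar
      (by fun_prop) h1
  refine ae_eq_of_integral_contDiff_smul_eq ?_ hcont.locallyIntegrable fun g hg hgs => ?_
  · exact (Lp.memLp _).locallyIntegrable (by norm_num)
  have hgs' : HasCompactSupport (fun x => (g x : ℂ)) := hgs.comp_left Complex.ofReal_zero
  have hg' : ContDiff ℝ (↑(⊤ : ℕ∞)) (fun x => (g x : ℂ)) := Complex.ofRealCLM.contDiff.comp hg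
  set G := hgs'.toSchwartzMap hg' with hG
  have hGx : ∀ x, G x = (g x : ℂ) := fun _ => rfl
  -- Both transforms are tested against G: the L² one passes to G as a tempered distribution, the
  -- integral one by Fubini.
  have e1 := congrArg (fun T => T G) (Lp.fourier_toTemperedDistribution_eq (h2.toLp f))
  simp only [TemperedDistribution.fourier_apply, Lp.toTemperedDistribution_apply,
    SchwartzMap.fourier_coe] at e1
  have e2 : ∫ x, (𝓕 (G : ℝ → ℂ) x) • (h2.toLp f) x = ∫ x, (𝓕 (G : ℝ → ℂ) x) • f x :=
    integral_congr_ae (by filter_upwards [h2.coeFn_toLp] with x hx; rw [hx])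
  have e3 : ∫ ξ, (𝓕 (G : ℝ → ℂ) ξ) • f ξ = ∫ x, G x • 𝓕 f x :=
    (VectorFourier.integral_fourierIntegral_smul_eq_flip (L := innerₗ ℝ) (μ := volume)
      (ν := volume) Real.continuous_fourierChar (by fun_prop) G.integrable h1).trans (by
        rw [flip_innerₗ]; rfl)
  simp only [hGx] at e1 e3
  simpa only [Complex.real_smul, smul_eq_mul] using e1.symm.trans (e2.trans e3)

theorem norm_sq_eq_integral (f : Lp ℂ 2 (volume : Measure ℝ)) :
    ‖f‖ ^ 2 = ∫ x, ‖f x‖ ^ 2 := by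
  have h := L2.inner_def (𝕜 := ℂ) f f
  rw [inner_self_eq_norm_sq_to_K] at h
  simp only [inner_self_eq_norm_sq_to_K] at h
  have h' : ((‖f‖ ^ 2 : ℝ) : ℂ) = ((∫ x, ‖f x‖ ^ 2 : ℝ) : ℂ) := by
    rw [← integral_complex_ofReal]
    push_cast
    exact h
  exact_mod_cast h'

theorem norm_convK_sq {a : ℝ} (ha : 0 ≤ a) (f : Lp ℂ 2 (volume : Measure ℝ)) :
    ‖convK a ha f‖ ^ 2
      = ∫ ν, symbol a (2 * Real.pi * ν) ^ 2 * ‖(𝓕 f : Lp ℂ 2 (volume : Measure ℝ)) ν‖ ^ 2 := by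
  have h : ‖convK a ha f‖ = ‖((memLp_symbol ha).toLp _ • 𝓕 f : Lp ℂ 2 (volume : Measure ℝ))‖ :=
    (Lp.fourierTransformₗᵢ ℝ ℂ).symm.norm_map _
  rw [h, norm_sq_eq_integral]
  refine integral_congr_ae ?_
  filter_upwards [Lp.coeFn_lpSMul (r := 2) ((memLp_symbol ha).toLp _) (𝓕 f),
    (memLp_symbol ha).coeFn_toLp] with ν h1 h2
  rw [h1, Pi.smul_apply', h2, norm_smul, mul_pow, Complex.norm_real, Real.norm_eq_abs, sq_abs]

theorem convK_smul {a : ℝ} (ha : 0 ≤ a) (c : ℂ) (f : Lp ℂ 2 (volume : Measure ℝ)) :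
    convK a ha (c • f) = c • convK a ha f := by
  unfold convK
  rw [FourierTransform.fourier_smul, ← Lp.smul_comm, FourierTransform.fourierInv_smul]

theorem convK_sub {a : ℝ} (ha : 0 ≤ a) (f g : Lp ℂ 2 (volume : Measure ℝ)) :
    convK a ha (f - g) = convK a ha f - convK a ha g := by
  unfold convK
  rw [sub_eq_add_neg, FourierTransform.fourier_add, Lp.add_smul, FourierTransform.fourierInv_add,
    FourierTransform.fourier_neg, Lp.smul_neg, FourierTransform.fourierInv_neg, sub_eq_add_neg]

theorem norm_convK_le {a : ℝ} (ha : 0 ≤ a) (f : Lp ℂ 2 (volume : Measure ℝ)) :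
    ‖convK a ha f‖ ≤ ‖f‖ := by
  have h : ‖convK a ha f‖ = ‖((memLp_symbol ha).toLp _ • 𝓕 f : Lp ℂ 2 (volume : Measure ℝ))‖ :=
    (Lp.fourierTransformₗᵢ ℝ ℂ).symm.norm_map _
  rw [h, ← Lp.norm_fourier_eq f]
  refine (Lp.norm_smul_le _ _).trans (mul_le_of_le_one_left (norm_nonneg _) ?_)
  rw [Lp.norm_toLp, eLpNorm_exponent_top]
  refine ENNReal.toReal_le_of_le_ofReal zero_le_one
    (eLpNormEssSup_le_of_ae_bound (Eventually.of_forall fun ν => ?_))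
  have h := symbol_mem ha (2 * Real.pi * ν)
  rw [Complex.norm_real, Real.norm_of_nonneg h.1]
  exact h.2

/-! ### Quadratic forms of Fourier multipliers -/

/-- The Fourier transform of a real function on the line. -/
def ft (g : ℝ → ℝ) (ν : ℝ) : ℂ := 𝓕 (fun x => (g x : ℂ)) ν

/-- The quadratic form of the Fourier multiplier `w`. -/
def qf (w : ℝ → ℝ) (g : ℝ → ℝ) : ℝ := ∫ ν, w ν * ‖ft g ν‖ ^ 2

theorem continuous_ft {g : ℝ → ℝ} (h1 : Integrable g) : Continuous (ft g) :=
    VectorFourier.fourierIntegral_continuous Real.continuous_fourierChar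
      (by fun_prop) h1.ofReal

theorem norm_ft_le (g : ℝ → ℝ) (ν : ℝ) : ‖ft g ν‖ ≤ ∫ x, |g x| := by
  refine (VectorFourier.norm_fourierIntegral_le_integral_norm _ _ _ _ _).trans (le_of_eq ?_)
  simp

theorem memLp_ft {g : ℝ → ℝ} (h1 : Integrable g) (h2 : MemLp g 2 volume) :
    MemLp (ft g) 2 volume :=
  (memLp_congr_ae (fourier_toLp_ae_eq h1.ofReal (h2.ofReal (K := ℂ)))).1 (Lp.memLp _)

theorem integrable_ft_sq {g : ℝ → ℝ} (h1 : Integrable g) (h2 : MemLp g 2 volume) :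
    Integrable fun ν => ‖ft g ν‖ ^ 2 :=
  (memLp_two_iff_integrable_sq_norm (memLp_ft h1 h2).1).1 (memLp_ft h1 h2)

theorem integral_ft_sq {g : ℝ → ℝ} (h1 : Integrable g) (h2 : MemLp g 2 volume) :
    ∫ ν, ‖ft g ν‖ ^ 2 = ∫ x, g x ^ 2 := by
  have h := norm_sq_eq_integral (𝓕 ((h2.ofReal (K := ℂ)).toLp _) : Lp ℂ 2 (volume : Measure ℝ))
  rw [Lp.norm_fourier_eq, norm_sq_eq_integral] at h
  refine Eq.trans (integral_congr_ae ?_) (h.symm.trans (integral_congr_ae ?_))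
  · filter_upwards [fourier_toLp_ae_eq h1.ofReal (h2.ofReal (K := ℂ))] with ν hν
    rw [hν]; rfl
  · filter_upwards [(h2.ofReal (K := ℂ)).coeFn_toLp] with x hx
    rw [hx, RCLike.norm_ofReal, sq_abs]

/-- `ν ↦ (tanh ξ / ξ) ^ (1 / 2)` with `ξ = 2 π ν`. -/
def ker (ν : ℝ) : ℝ := symbol (1 / 4) (2 * Real.pi * ν) ^ 2

theorem norm_convK_toLp_sq {g : ℝ → ℝ} (h1 : Integrable g) (h2 : MemLp g 2 volume) :
    ‖convK (1 / 4) (by norm_num) ((h2.ofReal (K := ℂ)).toLp _)‖ ^ 2 = qf ker g := by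
  rw [norm_convK_sq]
  refine integral_congr_ae ?_
  filter_upwards [fourier_toLp_ae_eq h1.ofReal (h2.ofReal (K := ℂ))] with ν hν
  rw [hν]; rfl

theorem integrable_mul_ft_sq {w : ℝ → ℝ} (hw : Measurable w) (hw' : ∀ ν, w ν ∈ Icc (0 : ℝ) 1)
    {g : ℝ → ℝ} (h1 : Integrable g) (h2 : MemLp g 2 volume) :
    Integrable fun ν => w ν * ‖ft g ν‖ ^ 2 :=
  (integrable_ft_sq h1 h2).bdd_mul (c := 1) hw.aestronglyMeasurable
    (Eventually.of_forall fun ν => by rw [Real.norm_of_nonneg (hw' ν).1]; exact (hw' ν).2)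

theorem qf_nonneg {w : ℝ → ℝ} (hw' : ∀ ν, w ν ∈ Icc (0 : ℝ) 1) (g : ℝ → ℝ) : 0 ≤ qf w g :=
  integral_nonneg fun ν => mul_nonneg (hw' ν).1 (sq_nonneg _)

theorem qf_le {w : ℝ → ℝ} (hw : Measurable w) (hw' : ∀ ν, w ν ∈ Icc (0 : ℝ) 1)
    {g : ℝ → ℝ} (h1 : Integrable g) (h2 : MemLp g 2 volume) : qf w g ≤ ∫ x, g x ^ 2 := by
  rw [← integral_ft_sq h1 h2]
  exact integral_mono (integrable_mul_ft_sq hw hw' h1 h2) (integrable_ft_sq h1 h2)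
    fun ν => mul_le_of_le_one_left (sq_nonneg _) (hw' ν).2

theorem ft_add {g h : ℝ → ℝ} (hg : Integrable g) (hh : Integrable h) (ν : ℝ) :
    ft (fun x => g x + h x) ν = ft g ν + ft h ν := by
  simp only [ft, Real.fourier_eq, Complex.ofReal_add, smul_add]
  exact integral_add ((Real.fourierIntegral_convergent_iff ν).2 hg.ofReal)
    ((Real.fourierIntegral_convergent_iff ν).2 hh.ofReal)

theorem ft_const_mul (c : ℝ) (g : ℝ → ℝ) (ν : ℝ) : ft (fun x => c * g x) ν = c * ft g ν := by
  simp only [ft, Real.fourier_eq, Complex.ofReal_mul]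
  rw [← integral_const_mul]
  congr 1; ext x
  simp only [Circle.smul_def, smul_eq_mul]; ring

theorem qf_const_mul (w : ℝ → ℝ) (c : ℝ) (g : ℝ → ℝ) :
    qf w (fun x => c * g x) = c ^ 2 * qf w g := by
  simp only [qf, ft_const_mul, norm_mul, Complex.norm_real, mul_pow, Real.norm_eq_abs, sq_abs]
  rw [← integral_const_mul]
  congr 1; ext x; ring

theorem ft_dilate {t : ℝ} (ht : 0 < t) (g : ℝ → ℝ) (ν : ℝ) :
    ft (fun x => g (x / t)) ν = t * ft g (t * ν) := by
  simp only [ft, Real.fourier_eq]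
  have h := Measure.integral_comp_div (fun x => Real.fourierChar (-inner ℝ x (t * ν)) • (g x : ℂ)) t
  rw [abs_of_pos ht, Complex.real_smul] at h
  rw [← h]
  congr 1; ext x
  congr 3
  simp; field_simp

theorem qf_dilate {t : ℝ} (ht : 0 < t) (w : ℝ → ℝ) (g : ℝ → ℝ) :
    qf w (fun x => g (x / t)) = t * qf (fun ν => w (ν / t)) g := by
  simp only [qf, ft_dilate ht, norm_mul, Complex.norm_real, mul_pow, Real.norm_eq_abs, sq_abs]
  have h := Measure.integral_comp_mul_left (fun ν => w (ν / t) * ‖ft g ν‖ ^ 2) t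
  simp only [mul_div_cancel_left₀ _ ht.ne', abs_of_pos (inv_pos.2 ht), smul_eq_mul] at h
  calc _ = ∫ ν, t ^ 2 * (w ν * ‖ft g (t * ν)‖ ^ 2) := by congr 1; ext ν; ring
    _ = _ := by rw [integral_const_mul, h]; field_simp

/-- The square root of `qf w` is a seminorm. -/
theorem sqrt_qf_add_le {w : ℝ → ℝ} (hw : Measurable w) (hw' : ∀ ν, w ν ∈ Icc (0 : ℝ) 1)
    {g h : ℝ → ℝ} (hg1 : Integrable g) (hg2 : MemLp g 2 volume) (hh1 : Integrable h)
    (hh2 : MemLp h 2 volume) :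
    √(qf w fun x => g x + h x) ≤ √(qf w g) + √(qf w h) := by
  -- The form is the squared L² norm of √w times the transform, so Minkowski's inequality applies.
  have key : ∀ k : ℝ → ℝ, Integrable k → MemLp k 2 volume →
      ∃ m : MemLp (fun ν => (√(w ν) : ℂ) * ft k ν) 2 volume, √(qf w k) = ‖m.toLp _‖ := by
    intro k h1 h2
    have hm : AEStronglyMeasurable (fun ν => (√(w ν) : ℂ) * ft k ν) volume :=
      (Complex.measurable_ofReal.comp hw.sqrt).aestronglyMeasurable.mul
        (continuous_ft h1).aestronglyMeasurable
    have e : ∀ ν, ‖(√(w ν) : ℂ) * ft k ν‖ ^ 2 = w ν * ‖ft k ν‖ ^ 2 := fun ν => by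
      rw [norm_mul, mul_pow, Complex.norm_real, Real.norm_eq_abs, sq_abs, Real.sq_sqrt (hw' ν).1]
    have m : MemLp (fun ν => (√(w ν) : ℂ) * ft k ν) 2 volume := by
      rw [memLp_two_iff_integrable_sq_norm hm]
      simp only [e]
      exact integrable_mul_ft_sq hw hw' h1 h2
    refine ⟨m, ?_⟩
    rw [Real.sqrt_eq_iff_mul_self_eq (qf_nonneg hw' k) (norm_nonneg _), ← sq, norm_sq_eq_integral]
    refine integral_congr_ae ?_
    filter_upwards [m.coeFn_toLp] with ν hν
    rw [hν, e]
  obtain ⟨m1, e1⟩ := key g hg1 hg2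
  obtain ⟨m2, e2⟩ := key h hh1 hh2
  obtain ⟨m3, e3⟩ := key _ (hg1.add hh1) (hg2.add hh2)
  have e4 : m3.toLp _ = m1.toLp _ + m2.toLp _ := by
    rw [← MemLp.toLp_add]
    refine MemLp.toLp_congr _ _ (Eventually.of_forall fun ν => ?_)
    change _ * ft (fun x => g x + h x) ν = _
    rw [ft_add hg1 hh1, mul_add]; rfl
  rw [e1, e2]
  exact (e3.trans (congrArg norm e4)).le.trans (norm_add_le _ _)

/-! ### Behaviour of tanh x / x and of the kernel under dilation -/

theorem hasDerivAt_tanh (x : ℝ) : HasDerivAt Real.tanh (1 / Real.cosh x ^ 2) x := by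
  have h := (Real.hasDerivAt_sinh x).div (Real.hasDerivAt_cosh x) (Real.cosh_pos x).ne'
  have e : Real.tanh = fun x => Real.sinh x / Real.cosh x := funext Real.tanh_eq_sinh_div_cosh
  rw [e]
  convert! h using 1
  rw [← Real.cosh_sq_sub_sinh_sq x]; ring

theorem tanh_strictMono : StrictMono Real.tanh :=
  strictMono_of_hasDerivAt_pos hasDerivAt_tanh fun x => by have := Real.cosh_pos x; positivity

/-- The derivative is 1/cosh²(x/t) − 1/cosh² x > 0. The function is x (tanhc(x/t) − tanhc x) for x >
0, so it measures the gain from dilation. -/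
theorem strictMonoOn_mul_tanh_div_sub {t : ℝ} (ht : 1 < t) :
    StrictMonoOn (fun x => t * Real.tanh (x / t) - Real.tanh x) (Ici 0) := by
  have ht0 : 0 < t := by linarith
  have hd : ∀ x : ℝ, HasDerivAt (fun x => t * Real.tanh (x / t) - Real.tanh x)
      (t * (1 / Real.cosh (x / t) ^ 2 * (1 / t)) - 1 / Real.cosh x ^ 2) x := fun x =>
    ((HasDerivAt.comp x (h₂ := Real.tanh) (h := fun x => x / t) (hasDerivAt_tanh (x / t))
      ((hasDerivAt_id x).div_const t)).const_mul t).sub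
      (hasDerivAt_tanh x)
  refine strictMonoOn_of_deriv_pos (convex_Ici 0)
    (fun x _ => (hd x).continuousAt.continuousWithinAt) fun x hx => ?_
  rw [interior_Ici] at hx
  rw [(hd x).deriv]
  have hx0 : 0 < x := hx
  have h1 : x / t < x := div_lt_self hx0 ht
  have h2 : Real.cosh (x / t) < Real.cosh x := by
    rw [Real.cosh_lt_cosh, abs_of_pos (by positivity), abs_of_pos hx0]; exact h1
  have h3 := Real.cosh_pos (x / t)
  have h4 : 1 / Real.cosh x ^ 2 < 1 / Real.cosh (x / t) ^ 2 :=
    one_div_lt_one_div_of_lt (by positivity) (by gcongr)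
  have h5 : t * (1 / Real.cosh (x / t) ^ 2 * (1 / t)) = 1 / Real.cosh (x / t) ^ 2 := by field_simp
  linarith

/-- The symbol `tanh x / x`, with the value `1` at `0`. -/
def tanhc (x : ℝ) : ℝ := if x = 0 then 1 else Real.tanh x / x

theorem tanhc_mem (x : ℝ) : tanhc x ∈ Icc (0 : ℝ) 1 := by
  unfold tanhc; split_ifs
  · simp
  · exact tanh_div_self_mem x

theorem tanhc_abs (x : ℝ) : tanhc |x| = tanhc x := by
  rcases abs_choice x with h | h <;> rw [h]
  simp [tanhc, Real.tanh_neg, neg_div_neg_eq]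

/-- From sinh x ≥ x and cosh x ≤ exp(x²/2) one gets tanhc x ≥ exp(−x²/2). -/
theorem one_sub_le_tanhc (x : ℝ) : 1 - x ^ 2 / 2 ≤ tanhc x := by
  rw [← sq_abs, ← tanhc_abs]
  have hx := abs_nonneg x
  generalize |x| = x at *
  rcases hx.eq_or_lt with rfl | hx
  · simp [tanhc]
  have h1 : Real.exp (-(x ^ 2 / 2)) ≤ tanhc x := by
    rw [tanhc, if_neg hx.ne', Real.tanh_eq_sinh_div_cosh, le_div_iff₀ hx,
      le_div_iff₀ (Real.cosh_pos x)]
    have h2 := Real.cosh_le_exp_half_sq x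
    have h3 := Real.self_le_sinh_iff.2 hx.le
    calc _ ≤ Real.exp (-(x ^ 2 / 2)) * x * Real.exp (x ^ 2 / 2) := by gcongr
      _ = x := by rw [mul_right_comm, ← Real.exp_add]; simp
      _ ≤ _ := h3
  have := Real.add_one_le_exp (-(x ^ 2 / 2))
  linarith

theorem tanhc_le (x : ℝ) (hx : x ≠ 0) : tanhc x ≤ 1 / |x| := by
  have h0 : |x| ≠ 0 := abs_ne_zero.2 hx
  rw [← tanhc_abs, tanhc, if_neg h0]
  gcongr
  exact (Real.tanh_lt_one _).le

theorem tanhc_div_le {t : ℝ} (ht : 1 < t) (x : ℝ) : tanhc (x / t) ≤ t * tanhc x := by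
  have ht0 : 0 < t := by linarith
  rw [← tanhc_abs, ← tanhc_abs x, abs_div, abs_of_pos ht0]
  have hx := abs_nonneg x
  generalize |x| = x at *
  rcases hx.eq_or_lt with rfl | hx
  · simp [tanhc, ht.le]
  rw [tanhc, tanhc, if_neg hx.ne', if_neg (by positivity), div_div_eq_mul_div, mul_comm,
    ← mul_div_assoc]
  gcongr
  exact tanh_strictMono.monotone (div_le_self hx.le ht.le)

theorem tanhc_le_div {t : ℝ} (ht : 1 < t) (x : ℝ) : tanhc x ≤ tanhc (x / t) := by
  have ht0 : 0 < t := by linarith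
  rw [← tanhc_abs, ← tanhc_abs (x / t), abs_div, abs_of_pos ht0]
  have hx := abs_nonneg x
  generalize |x| = x at *
  rcases hx.eq_or_lt with rfl | hx
  · simp [tanhc]
  have h := (strictMonoOn_mul_tanh_div_sub ht).monotoneOn self_mem_Ici hx.le hx.le
  simp only [zero_div, Real.tanh_zero, mul_zero, sub_zero] at h
  rw [tanhc, tanhc, if_neg hx.ne', if_neg (by positivity), div_div_eq_mul_div]
  gcongr
  linarith

/-- The increasing difference t tanh(x/t) − tanh x is at least its value c at ε, and c ≥ c tanh x
because tanh < 1; this makes the gain uniform up to infinity. -/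
theorem exists_mul_tanhc_le_div {t : ℝ} (ht : 1 < t) {ε : ℝ} (hε : 0 < ε) :
    ∃ c > 0, ∀ x, ε ≤ |x| → (1 + c) * tanhc x ≤ tanhc (x / t) := by
  have ht0 : 0 < t := by linarith
  have hmono := strictMonoOn_mul_tanh_div_sub ht
  refine ⟨t * Real.tanh (ε / t) - Real.tanh ε, ?_, fun x hx => ?_⟩
  · have h := hmono self_mem_Ici hε.le hε
    simpa using h
  rw [← tanhc_abs, ← tanhc_abs (x / t), abs_div, abs_of_pos ht0]
  generalize |x| = x at *
  have hx0 : 0 < x := hε.trans_le hx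
  have h1 := hmono.monotoneOn hε.le hx0.le hx
  have h0 := hmono self_mem_Ici hε.le hε
  simp only [zero_div, Real.tanh_zero, mul_zero, sub_zero] at h1 h0
  generalize t * Real.tanh (ε / t) - Real.tanh ε = c at *
  rw [tanhc, tanhc, if_neg hx0.ne', if_neg (by positivity), div_div_eq_mul_div, ← mul_div_assoc]
  refine div_le_div_of_nonneg_right ?_ hx0.le
  have h2 := mul_le_mul_of_nonneg_left (Real.tanh_lt_one x).le h0.le
  linarith

theorem ker_eq (ν : ℝ) : ker ν = √(tanhc (2 * Real.pi * ν)) := by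
  unfold ker symbol tanhc
  split_ifs
  · simp
  · rw [Real.sqrt_eq_rpow, ← Real.rpow_natCast, ← Real.rpow_mul (tanh_div_self_mem _).1]
    norm_num

theorem measurable_ker : Measurable ker :=
  ((measurable_symbol _).comp (measurable_const_mul _)).pow_const 2

theorem ker_mem (ν : ℝ) : ker ν ∈ Icc (0 : ℝ) 1 := by
  have h := symbol_mem (by norm_num : (0 : ℝ) ≤ 1 / 4) (2 * Real.pi * ν)
  exact ⟨sq_nonneg _, pow_le_one₀ h.1 h.2⟩

theorem one_sub_ker_le (ν : ℝ) : 1 - ker ν ≤ (2 * Real.pi * ν) ^ 2 / 2 := by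
  have h := tanhc_mem (2 * Real.pi * ν)
  have h1 := one_sub_le_tanhc (2 * Real.pi * ν)
  have h2 : tanhc (2 * Real.pi * ν) ≤ ker ν := by
    rw [ker_eq]
    exact Real.le_sqrt_of_sq_le (by nlinarith [h.1, h.2])
  linarith

theorem ker_le {R : ℝ} (hR : 0 < R) {ν : ℝ} (hν : R ≤ |ν|) : ker ν ≤ 1 / √R := by
  have h0 : ν ≠ 0 := abs_pos.1 (hR.trans_le hν)
  have hπ := Real.pi_gt_three
  rw [ker_eq, one_div, ← Real.sqrt_inv, ← one_div]
  refine Real.sqrt_le_sqrt ((tanhc_le _ (by positivity)).trans ?_)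
  rw [abs_mul, abs_of_pos (by positivity)]
  gcongr
  nlinarith

theorem ker_le_div {t : ℝ} (ht : 1 < t) (ν : ℝ) : ker ν ≤ ker (ν / t) := by
  rw [ker_eq, ker_eq, ← mul_div_assoc]
  exact Real.sqrt_le_sqrt (tanhc_le_div ht _)

theorem ker_div_le {t : ℝ} (ht : 1 < t) (ν : ℝ) : ker (ν / t) ≤ √t * ker ν := by
  rw [ker_eq, ker_eq, ← mul_div_assoc, ← Real.sqrt_mul (by linarith)]
  exact Real.sqrt_le_sqrt (tanhc_div_le ht _)

theorem exists_mul_ker_le_div {t : ℝ} (ht : 1 < t) {ε : ℝ} (hε : 0 < ε) :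
    ∃ κ > 0, ∀ ν, ε ≤ |ν| → (1 + κ) * ker ν ≤ ker (ν / t) := by
  obtain ⟨c, hc, h⟩ := exists_mul_tanhc_le_div ht hε
  have h1 : 1 < √(1 + c) := by rw [Real.lt_sqrt zero_le_one]; linarith
  refine ⟨√(1 + c) - 1, by linarith, fun ν hν => ?_⟩
  rw [ker_eq, ker_eq, ← mul_div_assoc, add_sub_cancel, ← Real.sqrt_mul (by linarith)]
  refine Real.sqrt_le_sqrt (h _ ?_)
  rw [abs_mul, abs_of_pos (by positivity)]
  nlinarith [Real.pi_gt_three]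

/-! ### Indicators of intervals -/

theorem norm_ft_indicator_le (L : ℝ) (hL : 0 ≤ L) {ν : ℝ} (hν : ν ≠ 0) :
    ‖ft ((Ioc 0 L).indicator 1) ν‖ ≤ 1 / (Real.pi * |ν|) := by
  have hπ := Real.pi_pos
  set c : ℂ := -(2 * Real.pi * ν) * Complex.I with hc
  have hc0 : c ≠ 0 := by
    rw [hc]; simp [hν, hπ.ne']
  have e : ft ((Ioc 0 L).indicator 1) ν = (Complex.exp (c * L) - Complex.exp (c * (0 : ℝ))) / c := by
    rw [← integral_exp_mul_complex hc0, intervalIntegral.integral_of_le hL,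
      ← integral_indicator measurableSet_Ioc]
    simp only [ft, Real.fourier_eq]
    congr 1; ext x
    by_cases hx : x ∈ Ioc 0 L
    · simp only [indicator_of_mem hx, Pi.one_apply, Circle.smul_def, Real.fourierChar_apply,
        Complex.ofReal_one, smul_eq_mul, mul_one, hc]
      congr 1
      simp; ring
    · simp [hx]
  have hn : ∀ x : ℝ, ‖Complex.exp (c * x)‖ = 1 := fun x => by
    rw [Complex.norm_exp]; simp [hc]
  have hcn : ‖c‖ = 2 * Real.pi * |ν| := by
    simp [hc, abs_of_pos hπ]
  rw [e, norm_div, hcn]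
  calc _ ≤ 2 / (2 * Real.pi * |ν|) := by
        gcongr
        refine (norm_sub_le _ _).trans ?_
        rw [hn, hn]; norm_num
    _ = _ := by field_simp

theorem integrable_indicator_one (L : ℝ) :
    Integrable ((Ioc 0 L).indicator (1 : ℝ → ℝ)) :=
  (integrable_indicator_iff measurableSet_Ioc).2
    (integrableOn_const (by simp) (by simp))

theorem memLp_indicator_one (L : ℝ) : MemLp ((Ioc 0 L).indicator (1 : ℝ → ℝ)) 2 volume :=
  memLp_indicator_const 2 measurableSet_Ioc 1 (Or.inr (by simp))

/-- The deficit 1 − ker is O(ν²) at 0 and cancels the 1/ν² bound on the transform, so the loss is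
bounded independently of L. -/
theorem le_qf_ker_indicator (L : ℝ) (hL : 0 ≤ L) :
    L - 3 * Real.pi ≤ qf ker ((Ioc 0 L).indicator 1) := by
  have i1 := integrable_indicator_one L
  have i2 := memLp_indicator_one L
  have h1 := integral_ft_sq i1 i2
  have h2 : ∫ x, ((Ioc 0 L).indicator (1 : ℝ → ℝ)) x ^ 2 = L := by
    have : ∀ x, ((Ioc 0 L).indicator (1 : ℝ → ℝ)) x ^ 2 = (Ioc 0 L).indicator (1 : ℝ → ℝ) x := by
      intro x; by_cases hx : x ∈ Ioc 0 L <;> simp [hx]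
    simp only [this]
    rw [integral_indicator_one measurableSet_Ioc]
    simp [hL]
  have h3 : ∫ ν, (1 - ker ν) * ‖ft ((Ioc 0 L).indicator 1) ν‖ ^ 2
      ≤ ∫ ν, 3 * (1 + ν ^ 2)⁻¹ := by
    refine integral_mono_of_nonneg (Eventually.of_forall fun ν => ?_)
      (integrable_inv_one_add_sq.const_mul 3) ?_
    · exact mul_nonneg (sub_nonneg.2 (ker_mem ν).2) (sq_nonneg _)
    · filter_upwards [compl_mem_ae_iff.2 (measure_singleton (0 : ℝ))] with ν hν
      have hν0 : ν ≠ 0 := hν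
      have k1 := one_sub_ker_le ν
      have k2 := ker_mem ν
      have hπ := Real.pi_gt_three
      have hs : 0 < ν ^ 2 := by positivity
      have k3 : ‖ft ((Ioc 0 L).indicator 1) ν‖ ^ 2 ≤ 1 / (Real.pi ^ 2 * ν ^ 2) := by
        refine (pow_le_pow_left₀ (norm_nonneg _) (norm_ft_indicator_le L hL hν0) 2).trans ?_
        rw [div_pow, mul_pow, sq_abs, one_pow]
      have k4 : (1 - ker ν) * ‖ft ((Ioc 0 L).indicator 1) ν‖ ^ 2
          ≤ (1 - ker ν) * (1 / (Real.pi ^ 2 * ν ^ 2)) :=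
        mul_le_mul_of_nonneg_left k3 (sub_nonneg.2 k2.2)
      refine k4.trans ?_
      rw [← div_eq_mul_inv, mul_one_div, div_le_div_iff₀ (by positivity) (by positivity)]
      -- Below 1/2, the bounds 1 − ker ≤ 2π²ν² and 1 + ν² ≤ 3/2 produce exactly the constant 3;
      -- above, 1 + ν² ≤ 3ν² suffices.
      rcases le_total (ν ^ 2) (1 / 2) with h | h
      · have : (1 - ker ν) * (1 + ν ^ 2) ≤ ((2 * Real.pi * ν) ^ 2 / 2) * (3 / 2) := by
          gcongr; linarith
        nlinarith
      · have : (1 - ker ν) * (1 + ν ^ 2) ≤ 1 * (1 + ν ^ 2) := by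
          gcongr; linarith [k2.1]
        have : 1 * ν ^ 2 ≤ Real.pi ^ 2 * ν ^ 2 := by gcongr; nlinarith
        linarith
  rw [integral_const_mul, integral_univ_inv_one_add_sq] at h3
  have h4 : ∫ ν, (1 - ker ν) * ‖ft ((Ioc 0 L).indicator 1) ν‖ ^ 2
      = L - qf ker ((Ioc 0 L).indicator 1) := by
    refine Eq.trans ?_ (congrArg (· - qf ker ((Ioc 0 L).indicator 1)) (h1.trans h2))
    rw [qf, ← integral_sub (integrable_ft_sq i1 i2)
      (integrable_mul_ft_sq measurable_ker ker_mem i1 i2)]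
    congr 1; ext ν; ring
  linarith

/-! ### The Orlicz function -/

theorem Psi_nonneg {α : ℝ} (hα : 0 < α) (y : ℝ) : 0 ≤ Psi α y :=
  le_trans (by positivity) (Psi_ge hα y)

theorem Psi_zero {α : ℝ} (hα : 0 < α) : Psi α 0 = 0 := by simp [Psi, hα]

theorem measurable_Psi (α : ℝ) : Measurable (Psi α) := by
  unfold Psi
  exact Measurable.ite (measurableSet_lt measurable_abs measurable_const) (by fun_prop)
    (by fun_prop)

theorem Psi_mul {α : ℝ} (hα : 0 < α) (y : ℝ) : Psi α (α * y) = α ^ 3 * Psi 1 y := by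
  have h : α * |y| < α ↔ |y| < 1 := mul_lt_iff_lt_one_right hα
  simp only [Psi, abs_mul, abs_of_pos hα, h]
  split_ifs <;> ring

theorem Psi_one_of_le {y : ℝ} (hy : 1 ≤ y) :
    Psi 1 y = (2 + 3 * (y - 1) + 3 * (y - 1) ^ 3) / 3 := by
  have h := abs_of_nonneg (zero_le_one.trans hy)
  rw [Psi, h, if_neg hy.not_gt]; ring

theorem Psi_one_of_mem {y : ℝ} (hy : y ∈ Ico (0 : ℝ) 1) : Psi 1 y = y ^ 2 - y ^ 3 / 3 := by
  rw [Psi, abs_of_nonneg hy.1, if_pos hy.2]; ring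

theorem Psi_abs (α y : ℝ) : Psi α |y| = Psi α y := by simp [Psi]

theorem Psi_ge_of_abs_le {δ : ℝ} (hδ : δ < 1) {y : ℝ} (hy : |y| ≤ δ) :
    (1 - δ / 3) * y ^ 2 ≤ Psi 1 y := by
  rw [← Psi_abs, ← sq_abs, Psi_one_of_mem ⟨abs_nonneg y, hy.trans_lt hδ⟩]
  nlinarith [mul_nonneg (sq_nonneg |y|) (sub_nonneg.2 hy)]

theorem abs_le_Psi_of_le_abs {δ : ℝ} (hδ : 0 < δ) {y : ℝ} (hy : δ ≤ |y|) :
    |y| ≤ 3 / δ * Psi 1 y := by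
  have h := Psi_ge one_pos y
  rw [← sq_abs] at h
  rw [div_mul_eq_mul_div, le_div_iff₀ hδ]
  nlinarith

/-! ### The extremal value of `y ^ 2 / Psi 1 y` -/

/-- The triple-angle formula with cos(5π/6) = −√3/2. The cubic is the critical-point equation of
y²/Psi 1 y on y > 1. -/
theorem B_cubic : 3 * B ^ 3 - 12 * B + 8 = 0 := by
  have h := Real.cos_three_mul (5 * Real.pi / 18)
  have e : 3 * (5 * Real.pi / 18) = Real.pi - Real.pi / 6 := by ring
  rw [e, Real.cos_pi_sub, Real.cos_pi_div_six] at h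
  have h3 : (√3) ^ 2 = 3 := Real.sq_sqrt (by norm_num)
  have h0 : √3 ≠ 0 := by positivity
  have e2 : √3 * B = 4 * Real.cos (5 * Real.pi / 18) := by unfold B; field_simp
  have e3 : Real.cos (5 * Real.pi / 18) = √3 * B / 4 := by linarith
  rw [e3] at h
  have e4 : √3 * (3 * B ^ 3 - 12 * B + 8) = 0 := by
    have : (√3) ^ 3 = 3 * √3 := by rw [pow_succ, h3]
    ring_nf at h ⊢
    rw [this] at h
    linarith
  exact (mul_eq_zero.1 e4).resolve_left h0

theorem B_mem : B ∈ Ioo (1.475 : ℝ) 1.485 := by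
  have h := B_cubic
  -- Excludes the smaller positive root of the cubic, which lies below 1.15.
  have h1 : 1.15 < B := by
    have h3 : √3 < 1.733 := by rw [Real.sqrt_lt' (by norm_num)]; norm_num
    have hc : 1 / 2 < Real.cos (5 * Real.pi / 18) := by
      rw [← Real.cos_pi_div_three]
      have := Real.pi_pos
      exact Real.cos_lt_cos_of_nonneg_of_le_pi (by positivity) (by linarith) (by linarith)
    have h0 : 0 < √3 := by positivity
    unfold B
    rw [div_mul_eq_mul_div, lt_div_iff₀ h0]
    linarith
  constructor
  · by_contra! hb
    nlinarith [mul_nonneg (sub_nonneg.2 h1.le) (sub_nonneg.2 hb),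
      mul_nonneg (mul_nonneg (sub_nonneg.2 h1.le) (sub_nonneg.2 hb)) (by linarith : (0 : ℝ) ≤ B)]
  · by_contra! hb
    nlinarith [mul_nonneg (sub_nonneg.2 hb) (sub_nonneg.2 hb),
      mul_nonneg (mul_nonneg (sub_nonneg.2 hb) (sub_nonneg.2 hb)) (by linarith : (0 : ℝ) ≤ B)]

/-- The maximum of `y ^ 2 / Psi 1 y`. -/
def maxRatio : ℝ := 3 * B ^ 2 / (2 + 3 * (B - 1) + 3 * (B - 1) ^ 3)

theorem B_denom_pos : 0 < 2 + 3 * (B - 1) + 3 * (B - 1) ^ 3 := by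
  have := pow_pos (sub_pos.2 (by linarith [B_mem.1] : 1 < B)) 3
  linarith [B_mem.1]

theorem lt_maxRatio : 3 / 2 < maxRatio := by
  have h := B_mem
  rw [maxRatio, lt_div_iff₀ B_denom_pos]
  nlinarith [B_cubic, h.1, h.2]

theorem maxRatio_eq : maxRatio = B ^ 2 / Psi 1 B := by
  rw [Psi_one_of_le (by linarith [B_mem.1]), maxRatio]
  have := B_denom_pos
  field_simp

/-- Below 1 the ratio is at most 3/2 < maxRatio. Above 1 the difference, reduced modulo the cubic,
has a double root at B and a positive cofactor. -/
theorem sq_le_maxRatio_mul_Psi (y : ℝ) : y ^ 2 ≤ maxRatio * Psi 1 y := by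
  rw [← Psi_abs, ← sq_abs]
  have hy := abs_nonneg y
  generalize |y| = y at *
  rcases lt_or_ge y 1 with h | h
  · have h1 := mul_le_mul_of_nonneg_right lt_maxRatio.le (Psi_nonneg one_pos y)
    rw [Psi_one_of_mem ⟨hy, h⟩] at *
    nlinarith [mul_nonneg (sq_nonneg y) (sub_nonneg.2 h.le)]
  · have hd := B_denom_pos
    have hc := B_cubic
    have hB := B_mem
    rw [Psi_one_of_le h, maxRatio, div_mul_div_comm, le_div_iff₀ (by positivity)]
    have e : 3 * B ^ 2 * (2 + 3 * (y - 1) + 3 * (y - 1) ^ 3)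
        - y ^ 2 * ((2 + 3 * (B - 1) + 3 * (B - 1) ^ 3) * 3)
        = 3 * ((y - B) ^ 2 * (3 * B ^ 2 * y - 4)) := by
      linear_combination (3 * y ^ 2 - 3 * B * y) * hc
    have h4 : 0 ≤ 3 * B ^ 2 * y - 4 := by nlinarith [hB.1]
    nlinarith [mul_nonneg (sq_nonneg (y - B)) h4]

/-! ### Admissible functions -/

/-- Integrable functions with `∫ Psi 1 g ≤ s`. -/
structure Adm (s : ℝ) (g : ℝ → ℝ) : Prop where
  integrable : Integrable g
  integrable_Psi : Integrable fun x => Psi 1 (g x)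
  integral_le : ∫ x, Psi 1 (g x) ≤ s

theorem Adm.memLp {s : ℝ} {g : ℝ → ℝ} (h : Adm s g) : MemLp g 2 volume := by
  rw [memLp_two_iff_integrable_sq h.integrable.1]
  refine (h.integrable_Psi.const_mul 3).mono' (h.integrable.1.pow 2)
    (Eventually.of_forall fun x => ?_)
  have := Psi_ge one_pos (g x)
  rw [Real.norm_of_nonneg (by positivity)]
  linarith

theorem Adm.integral_sq_le {s C : ℝ} {g : ℝ → ℝ} (h : Adm s g) (hC : 0 ≤ C)
    (hg : ∀ x, g x ^ 2 ≤ C * Psi 1 (g x)) : ∫ x, g x ^ 2 ≤ C * s :=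
  calc _ ≤ ∫ x, C * Psi 1 (g x) := integral_mono
        ((memLp_two_iff_integrable_sq h.integrable.1).1 h.memLp) (h.integrable_Psi.const_mul C) hg
    _ ≤ _ := by rw [integral_const_mul]; exact mul_le_mul_of_nonneg_left h.integral_le hC

theorem Adm.dilate {s t : ℝ} (ht : 0 < t) {g : ℝ → ℝ} (h : Adm s g) :
    Adm (t * s) fun x => g (x / t) where
  integrable := h.integrable.comp_div ht.ne'
  integrable_Psi := h.integrable_Psi.comp_div ht.ne'
  integral_le := by
    rw [Measure.integral_comp_div (fun x => Psi 1 (g x)), abs_of_pos ht, smul_eq_mul]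
    exact mul_le_mul_of_nonneg_left h.integral_le ht.le

/-- Replacing values by `0` preserves admissibility. -/
theorem Adm.comp {s : ℝ} {g : ℝ → ℝ} (h : Adm s g) {φ : ℝ → ℝ} (hφ : Measurable φ)
    (h0 : ∀ y, φ y = y ∨ φ y = 0) : Adm s fun x => φ (g x) := by
  have hle : ∀ y, Psi 1 (φ y) ≤ Psi 1 y := fun y => by
    rcases h0 y with e | e <;> rw [e]
    rw [Psi_zero one_pos]; exact Psi_nonneg one_pos y
  have hm := hφ.comp_aemeasurable h.integrable.1.aemeasurable
  have hi : Integrable fun x => Psi 1 (φ (g x)) :=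
    h.integrable_Psi.mono' ((measurable_Psi 1).comp_aemeasurable hm).aestronglyMeasurable
      (Eventually.of_forall fun x => by
        rw [Real.norm_of_nonneg (Psi_nonneg one_pos _)]; exact hle _)
  refine ⟨h.integrable.mono hm.aestronglyMeasurable (Eventually.of_forall fun x => ?_), hi,
    (integral_mono hi h.integrable_Psi fun x => hle _).trans h.integral_le⟩
  rcases h0 (g x) with e | e <;> simp [e]

theorem Adm.integral_abs_le {s δ : ℝ} {g : ℝ → ℝ} (h : Adm s g) (hδ : 0 < δ)
    (hg : ∀ x, g x = 0 ∨ δ ≤ |g x|) : ∫ x, |g x| ≤ 3 / δ * s :=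
  calc _ ≤ ∫ x, 3 / δ * Psi 1 (g x) := by
        refine integral_mono h.integrable.abs (h.integrable_Psi.const_mul _) fun x => ?_
        rcases hg x with e | e
        · simp [e, Psi_zero]
        · exact abs_le_Psi_of_le_abs hδ e
    _ ≤ _ := by
        rw [integral_const_mul]; exact mul_le_mul_of_nonneg_left h.integral_le (by positivity)

/-- Low frequencies are controlled by the `L¹` norm, high frequencies by the `L²` norm. -/
theorem qf_le_low_add_high {w : ℝ → ℝ} (hw : Measurable w) (hw' : ∀ ν, w ν ∈ Icc (0 : ℝ) 1)
    {g : ℝ → ℝ} (h1 : Integrable g) (h2 : MemLp g 2 volume) {R θ : ℝ} (hR : 0 < R) (hθ : 0 ≤ θ)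
    (hwR : ∀ ν, R < |ν| → w ν ≤ θ) :
    qf w g ≤ 2 * R * (∫ x, |g x|) ^ 2 + θ * ∫ x, g x ^ 2 := by
  have i1 : Integrable ((Icc (-R) R).indicator fun _ => (∫ x, |g x|) ^ 2) :=
    (integrable_indicator_iff measurableSet_Icc).2 (integrableOn_const (by simp) (by simp))
  have i2 := (integrable_ft_sq h1 h2).const_mul θ
  calc qf w g ≤ ∫ ν, (((Icc (-R) R).indicator fun _ => (∫ x, |g x|) ^ 2) ν
        + θ * ‖ft g ν‖ ^ 2) := by
        refine integral_mono (integrable_mul_ft_sq hw hw' h1 h2) (i1.add i2) fun ν => ?_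
        by_cases hν : ν ∈ Icc (-R) R
        · simp only [indicator_of_mem hν]
          have a1 : w ν * ‖ft g ν‖ ^ 2 ≤ ‖ft g ν‖ ^ 2 :=
            mul_le_of_le_one_left (sq_nonneg _) (hw' ν).2
          have a2 := pow_le_pow_left₀ (norm_nonneg _) (norm_ft_le g ν) 2
          have a3 : 0 ≤ θ * ‖ft g ν‖ ^ 2 := by positivity
          linarith
        · simp only [indicator_of_notMem hν, zero_add]
          refine mul_le_mul_of_nonneg_right (hwR ν ?_) (sq_nonneg _)
          by_contra! hc
          exact hν (abs_le.1 hc)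
    _ = _ := by
        rw [integral_add i1 i2, integral_const_mul, integral_ft_sq h1 h2,
          integral_indicator_const _ measurableSet_Icc]
        simp [hR.le]; left; ring

/-- Split g at height δ. The small part costs at most its L² norm, where `Psi 1` is nearly
quadratic; the large part is controlled in L¹ at low frequencies and in L² at high ones. -/
theorem Adm.sqrt_qf_le {s : ℝ} {g : ℝ → ℝ} (h : Adm s g) {w : ℝ → ℝ} (hw : Measurable w)
    (hw' : ∀ ν, w ν ∈ Icc (0 : ℝ) 1) {δ R θ : ℝ} (hδ : δ ∈ Ioo (0 : ℝ) 1) (hR : 0 < R)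
    (hθ : 0 ≤ θ) (hwR : ∀ ν, R < |ν| → w ν ≤ θ) :
    √(qf w g) ≤ √((1 - δ / 3)⁻¹ * s) + √(2 * R * (3 / δ * s) ^ 2 + θ * (3 * s)) := by
  set φ : ℝ → ℝ := fun y => if |y| ≤ δ then y else 0 with hφ
  set ψ : ℝ → ℝ := fun y => if |y| ≤ δ then 0 else y with hψ
  have hset : MeasurableSet {y : ℝ | |y| ≤ δ} := measurableSet_le measurable_abs measurable_const
  have a1 : Adm s fun x => φ (g x) :=
    h.comp (Measurable.ite hset measurable_id measurable_const)
      fun y => by by_cases hy : |y| ≤ δ <;> simp [hφ, hy]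
  have a2 : Adm s fun x => ψ (g x) :=
    h.comp (Measurable.ite hset measurable_const measurable_id)
      fun y => by by_cases hy : |y| ≤ δ <;> simp [hψ, hy]
  have e : (fun x => φ (g x) + ψ (g x)) = g := by
    funext x; simp only [hφ, hψ]; split_ifs <;> simp
  have hδ3 : 0 < 1 - δ / 3 := by linarith [hδ.2]
  have b := sqrt_qf_add_le hw hw' a1.integrable a1.memLp a2.integrable a2.memLp
  rw [e] at b
  refine b.trans (add_le_add (Real.sqrt_le_sqrt ?_) (Real.sqrt_le_sqrt ?_))
  · refine (qf_le hw hw' a1.integrable a1.memLp).trans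
      (a1.integral_sq_le (by positivity) fun x => ?_)
    rw [inv_mul_eq_div, le_div_iff₀' hδ3]
    refine Psi_ge_of_abs_le hδ.2 ?_
    simp only [hφ]; split_ifs with hx
    · exact hx
    · simpa using hδ.1.le
  · refine (qf_le_low_add_high hw hw' a2.integrable a2.memLp hR hθ hwR).trans ?_
    have c1 : ∫ x, |ψ (g x)| ≤ 3 / δ * s := a2.integral_abs_le hδ.1 fun x => by
      simp only [hψ]; split_ifs with hx
      · exact Or.inl rfl
      · exact Or.inr (not_le.1 hx).le
    have c2 : ∫ x, ψ (g x) ^ 2 ≤ 3 * s := a2.integral_sq_le (by norm_num) fun x => by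
      have := Psi_ge one_pos (ψ (g x)); linarith
    have c0 : 0 ≤ ∫ x, |ψ (g x)| := integral_nonneg fun x => abs_nonneg _
    gcongr

/-! ### The rescaled problem -/

/-- The supremum of the quadratic form over admissible functions. -/
def maxQf (s : ℝ) : ℝ := sSup (qf ker '' {g | Adm s g})

theorem adm_zero {s : ℝ} (hs : 0 ≤ s) : Adm s fun _ => 0 :=
  ⟨integrable_zero _ _ _, by simp [Psi_zero], by simpa [Psi_zero] using hs⟩

theorem Adm.qf_ker_le {s : ℝ} {g : ℝ → ℝ} (h : Adm s g) : qf ker g ≤ maxRatio * s :=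
  (qf_le measurable_ker ker_mem h.integrable h.memLp).trans
    (h.integral_sq_le (by linarith [lt_maxRatio]) fun x => sq_le_maxRatio_mul_Psi _)

theorem Adm.le_maxQf {s : ℝ} {g : ℝ → ℝ} (h : Adm s g) : qf ker g ≤ maxQf s :=
  le_csSup ⟨maxRatio * s, by rintro _ ⟨g, hg, rfl⟩; exact hg.qf_ker_le⟩ ⟨g, h, rfl⟩

theorem maxQf_le {s b : ℝ} (hs : 0 ≤ s) (hb : ∀ g, Adm s g → qf ker g ≤ b) : maxQf s ≤ b :=
  csSup_le ⟨_, _, adm_zero hs, rfl⟩ (by rintro _ ⟨g, hg, rfl⟩; exact hb g hg)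

theorem maxQf_le_maxRatio_mul {s : ℝ} (hs : 0 ≤ s) : maxQf s ≤ maxRatio * s :=
  maxQf_le hs fun _ h => h.qf_ker_le

/-- A plateau of height h and length s / Psi 1 h exhausts the constraint; the loss does not depend
on s. -/
theorem le_maxQf_of_indicator {s h : ℝ} (hs : 0 < s) (hh : 0 < h) :
    h ^ 2 / Psi 1 h * s - 3 * Real.pi * h ^ 2 ≤ maxQf s := by
  have hP : 0 < Psi 1 h := lt_of_lt_of_le (by positivity) (Psi_ge one_pos h)
  set L := s / Psi 1 h with hL
  have hL0 : 0 ≤ L := by positivity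
  have e : ∀ x, Psi 1 (h * (Ioc 0 L).indicator (1 : ℝ → ℝ) x)
      = Psi 1 h * (Ioc 0 L).indicator (1 : ℝ → ℝ) x := fun x => by
    by_cases hx : x ∈ Ioc 0 L <;> simp [hx, Psi_zero]
  have hadm : Adm s fun x => h * (Ioc 0 L).indicator (1 : ℝ → ℝ) x := by
    refine ⟨(integrable_indicator_one L).const_mul h, ?_, ?_⟩
    · simp only [e]; exact (integrable_indicator_one L).const_mul _
    · simp only [e]
      rw [integral_const_mul, integral_indicator_one measurableSet_Ioc]
      simp [hL0]
      rw [hL, mul_div_cancel₀ _ hP.ne']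
  have h1 := hadm.le_maxQf
  rw [qf_const_mul] at h1
  have h2 := mul_le_mul_of_nonneg_left (le_qf_ker_indicator L hL0) (sq_nonneg h)
  have e2 : h ^ 2 / Psi 1 h * s = h ^ 2 * L := by rw [hL]; ring
  rw [e2]
  linarith

theorem lt_maxQf {s : ℝ} (hs : 0 < s) : s < maxQf s := by
  have hπ := Real.pi_gt_three
  -- The gain over s is at least hs/3, first order in h, and the loss 3πh² is second order; 18π
  -- makes the loss at most hs/6.
  set h : ℝ := min (1 / 2) (s / (18 * Real.pi)) with hh
  have h0 : 0 < h := by positivity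
  have h1 : h ≤ 1 / 2 := min_le_left _ _
  have h2 : h * (18 * Real.pi) ≤ s := by
    rw [← le_div_iff₀ (by positivity)]; exact min_le_right _ _
  refine lt_of_lt_of_le ?_ (le_maxQf_of_indicator hs h0)
  have e : h ^ 2 / Psi 1 h = 1 / (1 - h / 3) := by
    rw [Psi_one_of_mem ⟨h0.le, by linarith⟩]
    have : 1 - h / 3 ≠ 0 := by linarith
    have : h ^ 2 - h ^ 3 / 3 ≠ 0 := by
      have : h ^ 2 - h ^ 3 / 3 = h ^ 2 * (1 - h / 3) := by ring
      rw [this]; positivity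
    rw [div_eq_div_iff this (by assumption)]; ring
  have h3 : 1 + h / 3 ≤ 1 / (1 - h / 3) := by
    rw [le_div_iff₀ (by linarith)]; nlinarith
  rw [e]
  nlinarith [mul_le_mul_of_nonneg_right h3 hs.le, mul_le_mul_of_nonneg_left h2 h0.le,
    mul_pos h0 hs]

theorem maxQf_mul_le {s t : ℝ} (hs : 0 < s) (ht : 1 < t) :
    maxQf (t * s) ≤ t * √t * maxQf s := by
  have ht0 : 0 < t := by linarith
  refine maxQf_le (by positivity) fun g hg => ?_
  have h1 := hg.dilate (inv_pos.2 ht0)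
  rw [inv_mul_cancel_left₀ ht0.ne'] at h1
  have h2 := h1.le_maxQf
  rw [qf_dilate (inv_pos.2 ht0), inv_mul_le_iff₀ ht0] at h2
  have h3 : qf ker g ≤ √t * qf (fun ν => ker (ν / t⁻¹)) g := by
    rw [qf, qf, ← integral_const_mul]
    refine integral_mono (integrable_mul_ft_sq measurable_ker ker_mem hg.integrable hg.memLp)
      ((integrable_mul_ft_sq (measurable_ker.comp (measurable_id.div_const t⁻¹))
        (fun _ => ker_mem _) hg.integrable hg.memLp).const_mul _) fun ν => ?_
    have := ker_div_le ht (ν / t⁻¹)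
    rw [div_div, inv_mul_cancel₀ ht0.ne', div_one] at this
    rw [← mul_assoc]
    exact mul_le_mul_of_nonneg_right this (sq_nonneg _)
  calc _ ≤ √t * (t * maxQf s) := h3.trans (mul_le_mul_of_nonneg_left h2 (Real.sqrt_nonneg t))
    _ = _ := by ring

theorem indicator_ker_mem (ε ν : ℝ) : (Icc (-ε) ε).indicator ker ν ∈ Icc (0 : ℝ) 1 := by
  by_cases hν : ν ∈ Icc (-ε) ε
  · rw [indicator_of_mem hν]; exact ker_mem ν
  · rw [indicator_of_notMem hν]; simp

/-- Low frequencies cannot contribute much more than the constraint. -/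
theorem exists_low_frequency_bound {s : ℝ} (hs : 0 < s) {b : ℝ} (hb : s < b) :
    ∃ ε > 0, ∀ g, Adm s g → qf ((Icc (-ε) ε).indicator ker) g ≤ b := by
  have hlim1 : Tendsto (fun δ : ℝ => √((1 - δ / 3)⁻¹ * s)) (𝓝[>] 0) (𝓝 √s) := by
    have : ContinuousAt (fun δ : ℝ => √((1 - δ / 3)⁻¹ * s)) 0 := by
      refine ((ContinuousAt.inv₀ (by fun_prop) (by norm_num)).mul continuousAt_const).sqrt
    have h := this.tendsto
    simp only [zero_div, sub_zero, inv_one, one_mul] at h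
    exact h.mono_left nhdsWithin_le_nhds
  obtain ⟨δ, hδ1, hδ⟩ := ((hlim1.eventually_lt_const (Real.sqrt_lt_sqrt hs.le hb)).and
    (Ioo_mem_nhdsGT one_pos)).exists
  -- With δ fixed, R → 0 removes the contribution of the large values; θ = 0 since the multiplier
  -- vanishes beyond R.
  have hlim2 : Tendsto (fun R : ℝ => √((1 - δ / 3)⁻¹ * s)
      + √(2 * R * (3 / δ * s) ^ 2 + 0 * (3 * s))) (𝓝[>] 0) (𝓝 √((1 - δ / 3)⁻¹ * s)) := by
    have : Continuous (fun R : ℝ => √((1 - δ / 3)⁻¹ * s)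
      + √(2 * R * (3 / δ * s) ^ 2 + 0 * (3 * s))) := by fun_prop
    have h := this.tendsto 0
    simp only [mul_zero, zero_mul, add_zero, Real.sqrt_zero] at h
    simpa using h.mono_left nhdsWithin_le_nhds
  obtain ⟨ε, hε1, hε⟩ := ((hlim2.eventually_lt_const hδ1).and self_mem_nhdsWithin).exists
  refine ⟨ε, hε, fun g hg => ?_⟩
  have h := hg.sqrt_qf_le (measurable_ker.indicator measurableSet_Icc)
    (indicator_ker_mem ε) hδ hε le_rfl fun ν hν => ?_
  · exact ((Real.sqrt_lt_sqrt_iff (qf_nonneg (indicator_ker_mem ε) g)).1 (h.trans_lt hε1)).le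
  · rw [indicator_of_notMem]
    exact fun hc => hν.not_ge (abs_le.2 hc)

theorem mul_maxQf_lt {s t : ℝ} (hs : 0 < s) (ht : 1 < t) : t * maxQf s < maxQf (t * s) := by
  have ht0 : 0 < t := by linarith
  have hlt := lt_maxQf hs
  obtain ⟨b, hb1, hb2⟩ := exists_between hlt
  obtain ⟨ε, hε, hlow⟩ := exists_low_frequency_bound hs hb1
  obtain ⟨κ, hκ, hker⟩ := exists_mul_ker_le_div ht hε
  -- Pointwise (1+κ) ker(ν) ≤ ker(ν/t) + κ ker(ν) 1_{|ν| ≤ ε}. The supremum over g then gives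
  -- strictness because b < M(s).
  have key : ∀ g, Adm s g → (1 + κ) * qf ker g ≤ maxQf (t * s) / t + κ * b := fun g hg => by
    have i1 := integrable_mul_ft_sq measurable_ker ker_mem hg.integrable hg.memLp
    have i2 := integrable_mul_ft_sq (measurable_ker.indicator measurableSet_Icc)
      (indicator_ker_mem ε) hg.integrable hg.memLp
    have i3 : Integrable fun ν => ker (ν / t) * ‖ft g ν‖ ^ 2 :=
      integrable_mul_ft_sq (measurable_ker.comp (measurable_id.div_const t))
        (fun _ => ker_mem _) hg.integrable hg.memLp
    have h1 : (1 + κ) * qf ker g ≤ qf (fun ν => ker (ν / t)) g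
        + κ * qf ((Icc (-ε) ε).indicator ker) g := by
      simp only [qf]
      rw [← integral_const_mul, ← integral_const_mul, ← integral_add i3 (i2.const_mul κ)]
      refine integral_mono (i1.const_mul _) (i3.add (i2.const_mul κ)) fun ν => ?_
      have hsq := sq_nonneg ‖ft g ν‖
      by_cases hν : ν ∈ Icc (-ε) ε
      · simp only [indicator_of_mem hν]
        nlinarith [mul_le_mul_of_nonneg_right (ker_le_div ht ν) hsq]
      · simp only [indicator_of_notMem hν]
        have := hker ν (by by_contra! hc; exact hν (abs_le.1 hc.le))
        nlinarith [mul_le_mul_of_nonneg_right this hsq]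
    have h2 := (hg.dilate ht0).le_maxQf
    rw [qf_dilate ht0, ← le_div_iff₀' ht0] at h2
    have h3 := mul_le_mul_of_nonneg_left (hlow g hg) hκ.le
    linarith
  have h4 : maxQf s ≤ (maxQf (t * s) / t + κ * b) / (1 + κ) :=
    maxQf_le hs.le fun g hg => by rw [le_div_iff₀' (by linarith)]; exact key g hg
  rw [le_div_iff₀' (by linarith)] at h4
  rw [← lt_div_iff₀' ht0]
  nlinarith

/-- The cutoff R = s^(−1/2) bounds ker beyond R by s^(1/4), so the large values contribute
O(s^(3/2)) + O(s^(5/4)) = o(s). -/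
theorem eventually_maxQf_le {b : ℝ} (hb : 1 < b) : ∀ᶠ s in 𝓝[>] 0, maxQf s ≤ b * s := by
  have hlim1 : Tendsto (fun δ : ℝ => √((1 - δ / 3)⁻¹)) (𝓝[>] 0) (𝓝 √1) := by
    have : ContinuousAt (fun δ : ℝ => √((1 - δ / 3)⁻¹)) 0 :=
      (ContinuousAt.inv₀ (by fun_prop) (by norm_num)).sqrt
    have h := this.tendsto
    simp only [zero_div, sub_zero, inv_one] at h
    exact h.mono_left nhdsWithin_le_nhds
  obtain ⟨δ, hδ1, hδ⟩ := ((hlim1.eventually_lt_const (Real.sqrt_lt_sqrt zero_le_one hb)).and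
    (Ioo_mem_nhdsGT one_pos)).exists
  have hlim2 : Tendsto (fun s : ℝ => √((1 - δ / 3)⁻¹)
      + √(2 * (√s * (3 / δ) ^ 2) + √(√s) * 3)) (𝓝[>] 0) (𝓝 √((1 - δ / 3)⁻¹)) := by
    have : Continuous (fun s : ℝ => √((1 - δ / 3)⁻¹)
      + √(2 * (√s * (3 / δ) ^ 2) + √(√s) * 3)) := by fun_prop
    have h := this.tendsto 0
    simp only [mul_zero, zero_mul, add_zero, Real.sqrt_zero] at h
    exact h.mono_left nhdsWithin_le_nhds
  filter_upwards [hlim2.eventually_lt_const hδ1, self_mem_nhdsWithin] with s hs1 hs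
  have hs : 0 < s := hs
  have hq : 0 < √s := Real.sqrt_pos.2 hs
  refine maxQf_le hs.le fun g hg => ?_
  have h := hg.sqrt_qf_le measurable_ker ker_mem hδ (R := 1 / √s) (θ := √√s) (by positivity)
    (by positivity) fun ν hν => ?_
  · have e : 2 * (1 / √s) * (3 / δ * s) ^ 2 + √√s * (3 * s)
        = (2 * (√s * (3 / δ) ^ 2) + √√s * 3) * s := by
      have : s ^ 2 = √s * (√s * s) := by rw [← mul_assoc, Real.mul_self_sqrt hs.le]; ring
      rw [mul_pow, this]; field_simp
    rw [e, Real.sqrt_mul' _ hs.le, Real.sqrt_mul' _ hs.le, ← add_mul] at h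
    have h2 : √(qf ker g) ≤ √(b * s) := by
      rw [Real.sqrt_mul' _ hs.le]
      exact h.trans (mul_le_mul_of_nonneg_right hs1.le hq.le)
    exact (Real.sqrt_le_sqrt_iff (by positivity)).1 h2
  · refine (ker_le (by positivity) hν.le).trans (le_of_eq ?_)
    rw [Real.sqrt_div zero_le_one, Real.sqrt_one, one_div_one_div]

/-! ### Reduction of `J` to the rescaled problem -/

theorem integrable_Psi_of_lintegral_le {α : ℝ} (hα : 0 < α) {f : ℝ → ℝ}
    (hm : AEStronglyMeasurable f volume) (h : ∫⁻ x, ENNReal.ofReal (Psi α (f x)) ≤ 1) :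
    Integrable (fun x => Psi α (f x)) ∧ ∫ x, Psi α (f x) ≤ 1 := by
  have hm' : AEStronglyMeasurable (fun x => Psi α (f x)) volume :=
    ((measurable_Psi α).comp_aemeasurable hm.aemeasurable).aestronglyMeasurable
  have h0 : 0 ≤ᵐ[volume] fun x => Psi α (f x) := Eventually.of_forall fun x => Psi_nonneg hα _
  refine ⟨⟨hm', (hasFiniteIntegral_iff_ofReal h0).2 (h.trans_lt ENNReal.one_lt_top)⟩, ?_⟩
  rw [integral_eq_lintegral_of_nonneg_ae h0 hm']
  exact ENNReal.toReal_le_of_le_ofReal zero_le_one (by simpa using h)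

/-- The norm of `K_{1/4} * f` for real `f`. -/
def normK {f : ℝ → ℝ} (hf : MemLp f 2 (volume : Measure ℝ)) : ℝ :=
  ‖convK (1 / 4) (by norm_num) ((hf.ofReal (K := ℂ)).toLp _)‖

theorem memLp_div {f : ℝ → ℝ} (hf : MemLp f 2 (volume : Measure ℝ)) (l : ℝ) :
    MemLp (fun x => f x / l) 2 (volume : Measure ℝ) := by
  simpa only [div_eq_mul_inv] using hf.mul_const l⁻¹

theorem normK_div {f : ℝ → ℝ} (hf : MemLp f 2 (volume : Measure ℝ)) {l : ℝ} (hl : 0 < l)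
    (hf' : MemLp (fun x => f x / l) 2 (volume : Measure ℝ)) : normK hf' = normK hf / l := by
  have e : (hf'.ofReal (K := ℂ)).toLp _ = (l⁻¹ : ℂ) • (hf.ofReal (K := ℂ)).toLp _ := by
    rw [← MemLp.toLp_const_smul]
    refine MemLp.toLp_congr _ _ (Eventually.of_forall fun x => ?_)
    simp; ring
  rw [normK, e, convK_smul, norm_smul, norm_inv, Complex.norm_real, Real.norm_of_nonneg hl.le,
    normK, inv_mul_eq_div]

theorem normK_le_add {f g : ℝ → ℝ} (hf : MemLp f 2 (volume : Measure ℝ))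
    (hg : MemLp g 2 (volume : Measure ℝ)) :
    normK hf ≤ normK hg + (eLpNorm (f - g) 2 volume).toReal := by
  have h := norm_convK_le (a := 1 / 4) (by norm_num)
    ((hf.ofReal (K := ℂ)).toLp _ - (hg.ofReal (K := ℂ)).toLp _)
  rw [convK_sub] at h
  have h2 := norm_le_norm_add_norm_sub' (convK (1 / 4) (by norm_num) ((hf.ofReal (K := ℂ)).toLp _))
    (convK (1 / 4) (by norm_num) ((hg.ofReal (K := ℂ)).toLp _))
  refine h2.trans (add_le_add le_rfl (h.trans (le_of_eq ?_)))
  rw [← MemLp.toLp_sub, Lp.norm_toLp]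
  congr 1
  refine eLpNorm_congr_norm_ae (Eventually.of_forall fun x => ?_)
  change ‖(f x : ℂ) - (g x : ℂ)‖ = ‖f x - g x‖
  rw [← Complex.ofReal_sub, Complex.norm_real]

theorem normK_le_of_lintegral_le {α : ℝ} (hα : 0 < α) {f : ℝ → ℝ}
    (hf : MemLp f 2 (volume : Measure ℝ)) (h : ∫⁻ x, ENNReal.ofReal (Psi α (f x)) ≤ 1) :
    normK hf ≤ α * √(maxQf (α ^ 3)⁻¹) := by
  refine le_of_forall_pos_le_add fun ε hε => ?_
  obtain ⟨hi, hle⟩ := integrable_Psi_of_lintegral_le hα hf.1 h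
  -- f is only in L²; truncation to a set of finite measure makes it integrable at an L² cost ε.
  obtain ⟨A, hA, hAfin, hAε⟩ := hf.exists_eLpNorm_indicator_compl_lt (by norm_num)
    (ENNReal.ofReal_pos.2 hε).ne'
  have hg : MemLp (A.indicator f) 2 volume := hf.indicator hA
  have hg1 : Integrable (A.indicator f) := by
    rw [integrable_indicator_iff hA]
    have : IsFiniteMeasure (volume.restrict A) := ⟨by simpa using hAfin⟩
    exact (hf.restrict A).integrable (by norm_num)
  have hP : ∀ x, Psi 1 (α⁻¹ * A.indicator f x)
      = (α ^ 3)⁻¹ * A.indicator (fun x => Psi α (f x)) x := fun x => by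
    have e := Psi_mul hα (α⁻¹ * A.indicator f x)
    rw [mul_inv_cancel_left₀ hα.ne'] at e
    rw [eq_inv_mul_iff_mul_eq₀ (by positivity), ← e]
    by_cases hx : x ∈ A <;> simp [hx, Psi_zero hα]
  have hadm : Adm (α ^ 3)⁻¹ fun x => α⁻¹ * A.indicator f x := by
    refine ⟨hg1.const_mul _, ?_, ?_⟩ <;> simp only [hP]
    · exact (hi.indicator hA).const_mul _
    · rw [integral_const_mul]
      refine mul_le_of_le_one_right (by positivity) (le_trans ?_ hle)
      rw [integral_indicator hA]
      exact setIntegral_le_integral hi (Eventually.of_forall fun x => Psi_nonneg hα _)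
  have h1 := hadm.le_maxQf
  rw [qf_const_mul, ← norm_convK_toLp_sq hg1 hg] at h1
  have h2 : normK hg ≤ α * √(maxQf (α ^ 3)⁻¹) := by
    rw [← div_le_iff₀' hα]
    refine Real.le_sqrt_of_sq_le ?_
    rw [div_eq_inv_mul, mul_pow]
    exact h1
  refine (normK_le_add hf hg).trans (add_le_add h2 ?_)
  refine ENNReal.toReal_le_of_le_ofReal hε.le ?_
  have e : f - A.indicator f = Aᶜ.indicator f := by rw [indicator_compl]
  rw [e]
  exact hAε.le

theorem normK_le_of_gaugeNorm_eq_one {α : ℝ} (hα : 0 < α) {f : ℝ → ℝ}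
    (hf : MemLp f 2 (volume : Measure ℝ)) (h : gaugeNorm (Psi α) f = 1) :
    normK hf ≤ α * √(maxQf (α ^ 3)⁻¹) := by
  have hlim : Tendsto (fun η : ℝ => α * √(maxQf (α ^ 3)⁻¹) * η) (𝓝[>] 1)
      (𝓝 (α * √(maxQf (α ^ 3)⁻¹) * 1)) :=
    ((continuous_const_mul _).tendsto 1).mono_left nhdsWithin_le_nhds
  rw [mul_one] at hlim
  refine ge_of_tendsto hlim ?_
  filter_upwards [self_mem_nhdsWithin] with η hη
  -- The infimum of the empty set is 0 by convention, which gauge norm 1 rules out.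
  have hne : {l : ℝ | 0 < l ∧ ∫⁻ x, ENNReal.ofReal (Psi α (f x / l)) ≤ 1}.Nonempty := by
    by_contra! hc
    rw [gaugeNorm, hc, Real.sInf_empty] at h
    exact zero_ne_one h
  obtain ⟨l, ⟨hl0, hl⟩, hlη⟩ := exists_lt_of_csInf_lt hne (h.trans_lt hη)
  have h1 := normK_le_of_lintegral_le hα (memLp_div hf l) hl
  rw [normK_div hf hl0, div_le_iff₀ hl0] at h1
  exact h1.trans (by gcongr)

open scoped Pointwise in
theorem gaugeNorm_div (Ψ f : ℝ → ℝ) {N : ℝ} (hN : 0 < N) :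
    gaugeNorm Ψ (fun x => f x / N) = gaugeNorm Ψ f / N := by
  have e : {l : ℝ | 0 < l ∧ ∫⁻ x, ENNReal.ofReal (Ψ (f x / N / l)) ≤ 1}
      = N⁻¹ • {l : ℝ | 0 < l ∧ ∫⁻ x, ENNReal.ofReal (Ψ (f x / l)) ≤ 1} := by
    ext l
    rw [mem_inv_smul_set_iff₀ hN.ne']
    simp only [mem_ofPred_eq, smul_eq_mul, div_div, mul_pos_iff_of_pos_left hN]
  rw [gaugeNorm, e, Real.sInf_smul_of_nonneg (inv_nonneg.2 hN.le), smul_eq_mul, inv_mul_eq_div]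
  rfl

theorem J_eq {α : ℝ} (hα : 0 < α) : J α = α * √(maxQf (α ^ 3)⁻¹) := by
  have hbdd : BddAbove {r : ℝ | ∃ (f : ℝ → ℝ) (hf : MemLp f 2 (volume : Measure ℝ)),
      MemOrlicz (Psi α) f ∧ gaugeNorm (Psi α) f = 1 ∧ r = normK hf} :=
    ⟨_, by rintro _ ⟨f, hf, -, h, rfl⟩; exact normK_le_of_gaugeNorm_eq_one hα hf h⟩
  have hJ : J α = sSup {r : ℝ | ∃ (f : ℝ → ℝ) (hf : MemLp f 2 (volume : Measure ℝ)),
      MemOrlicz (Psi α) f ∧ gaugeNorm (Psi α) f = 1 ∧ r = normK hf} := rfl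
  have hJ0 : 0 ≤ J α := by
    rw [hJ]
    exact Real.sSup_nonneg (by rintro _ ⟨f, hf, -, -, rfl⟩; exact norm_nonneg _)
  refine le_antisymm ?_ ?_
  · rw [hJ]
    refine Real.sSup_le ?_ (by positivity)
    rintro _ ⟨f, hf, -, h, rfl⟩
    exact normK_le_of_gaugeNorm_eq_one hα hf h
  rw [← le_div_iff₀' hα]
  refine Real.sqrt_le_iff.2 ⟨by positivity, maxQf_le (by positivity) fun g hg => ?_⟩
  -- A nonzero form forces f = αg to be nonzero in L², hence N > 0. As N ≤ 1, dividing f by N gives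
  -- a competitor of gauge norm 1 with no smaller norm.
  rcases (qf_nonneg ker_mem g).eq_or_lt with hq | hq
  · rw [← hq]; positivity
  set f : ℝ → ℝ := fun x => α * g x with hfdef
  have hf1 : Integrable f := hg.integrable.const_mul α
  have hf : MemLp f 2 volume := hg.memLp.const_mul α
  have hqf : normK hf ^ 2 = α ^ 2 * qf ker g := by
    rw [normK, norm_convK_toLp_sq hf1 hf, qf_const_mul]
  have hPi : Integrable fun x => Psi α (f x) := by
    simp only [hfdef, Psi_mul hα]; exact hg.integrable_Psi.const_mul _
  have hPle : ∫ x, Psi α (f x) ≤ 1 := by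
    simp only [hfdef, Psi_mul hα]
    rw [integral_const_mul, ← le_div_iff₀' (by positivity), one_div]
    exact hg.integral_le
  have hP1 : ∫⁻ x, ENNReal.ofReal (Psi α (f x)) ≤ 1 := by
    rw [← ofReal_integral_eq_lintegral_ofReal hPi (Eventually.of_forall fun x => Psi_nonneg hα _)]
    exact ENNReal.ofReal_le_one.2 hPle
  set S : Set ℝ := {l : ℝ | 0 < l ∧ ∫⁻ x, ENNReal.ofReal (Psi α (f x / l)) ≤ 1} with hS
  have h1S : (1 : ℝ) ∈ S := ⟨one_pos, by simpa using hP1⟩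
  have hf2 : 0 < ∫ x, f x ^ 2 := by
    refine lt_of_lt_of_le ?_ (qf_le measurable_ker ker_mem hf1 hf)
    rw [qf_const_mul]; positivity
  have hlow : ∀ l ∈ S, √(α / 3 * ∫ x, f x ^ 2) ≤ l := fun l hl => by
    refine Real.sqrt_le_iff.2 ⟨hl.1.le, ?_⟩
    obtain ⟨i1, i2⟩ := integrable_Psi_of_lintegral_le hα (memLp_div hf l).1 hl.2
    have i3 : ∫ x, α / 3 / l ^ 2 * f x ^ 2 ≤ ∫ x, Psi α (f x / l) := by
      refine integral_mono (((memLp_two_iff_integrable_sq hf.1).1 hf).const_mul _) i1 fun x => ?_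
      refine le_trans (le_of_eq ?_) (Psi_ge hα _)
      ring
    rw [integral_const_mul] at i3
    have i4 := i3.trans i2
    have hl2 : 0 < l ^ 2 := pow_pos hl.1 2
    rwa [div_mul_eq_mul_div, div_le_one hl2] at i4
  set N := gaugeNorm (Psi α) f with hN
  have hN0 : 0 < N := lt_of_lt_of_le (by positivity) (le_csInf ⟨1, h1S⟩ hlow)
  have hN1 : N ≤ 1 := csInf_le ⟨0, fun l hl => hl.1.le⟩ h1S
  have hf' : MemLp (fun x => f x / N) 2 volume := memLp_div hf N
  have hmem : normK hf' ≤ J α := by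
    rw [hJ]
    refine le_csSup hbdd ⟨_, hf', ⟨hf'.1, N, hN0, ?_⟩, ?_, rfl⟩
    · simp only [mul_div_cancel₀ _ hN0.ne']
      exact hP1.trans_lt ENNReal.one_lt_top
    · rw [gaugeNorm_div _ _ hN0, ← hN, div_self hN0.ne']
  rw [normK_div hf hN0] at hmem
  have hle : normK hf ≤ J α :=
    (le_div_self (norm_nonneg _) hN0 hN1).trans hmem
  rw [div_pow, le_div_iff₀' (by positivity), ← hqf]
  exact pow_le_pow_left₀ (norm_nonneg _) hle 2

theorem mul_J_sq {α : ℝ} (hα : 0 < α) :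
    α * J α ^ 2 = maxQf (α ^ 3)⁻¹ / (α ^ 3)⁻¹ := by
  have h : 0 < (α ^ 3)⁻¹ := by positivity
  rw [J_eq hα, mul_pow, Real.sq_sqrt (h.trans (lt_maxQf h)).le, div_inv_eq_mul]
  ring

/-! ### The ratio `maxQf s / s` -/

theorem maxQf_div_lt {s s' : ℝ} (hs : 0 < s) (h : s < s') : maxQf s / s < maxQf s' / s' := by
  have hs' := hs.trans h
  have h1 := mul_maxQf_lt hs ((one_lt_div hs).2 h)
  rw [div_mul_cancel₀ _ hs.ne'] at h1
  rw [lt_div_iff₀ hs']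
  calc _ = s' / s * maxQf s := by ring
    _ < _ := h1

theorem maxQf_div_le {s s' : ℝ} (hs : 0 < s) (h : s < s') :
    maxQf s' / s' ≤ √(s' / s) * (maxQf s / s) := by
  have hs' := hs.trans h
  have h1 := maxQf_mul_le hs ((one_lt_div hs).2 h)
  rw [div_mul_cancel₀ _ hs.ne'] at h1
  rw [div_le_iff₀ hs']
  refine h1.trans (le_of_eq ?_)
  ring

theorem continuousOn_maxQf_div : ContinuousOn (fun s => maxQf s / s) (Ioi 0) := by
  intro s₀ hs₀
  have hs₀ : 0 < s₀ := hs₀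
  refine ContinuousAt.continuousWithinAt ?_
  have hF : ∀ s, 0 < s → 0 < maxQf s / s := fun s hs => div_pos (hs.trans (lt_maxQf hs)) hs
  have hsq : ContinuousAt (fun s => √(s / s₀)) s₀ := by fun_prop
  -- On either side of s₀, monotonicity and the √ growth bound confine the ratio between 1 and
  -- √(s/s₀) times its value at s₀.
  have hlo : ContinuousAt (fun s => min 1 √(s / s₀) * (maxQf s₀ / s₀)) s₀ :=
    (continuousAt_const.min hsq).mul continuousAt_const
  have hhi : ContinuousAt (fun s => max 1 √(s / s₀) * (maxQf s₀ / s₀)) s₀ :=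
    (continuousAt_const.max hsq).mul continuousAt_const
  have e1 := hlo.tendsto
  have e2 := hhi.tendsto
  simp only [div_self hs₀.ne', Real.sqrt_one, min_self, max_self, one_mul] at e1 e2
  refine tendsto_of_tendsto_of_tendsto_of_le_of_le' e1 e2 ?_ ?_ <;>
    filter_upwards [Ioi_mem_nhds hs₀] with s hs <;> have hs : 0 < s := hs <;>
    rcases lt_trichotomy s s₀ with h | rfl | h
  · refine (mul_le_mul_of_nonneg_right (min_le_right _ _) (hF _ hs₀).le).trans ?_
    refine (mul_le_mul_of_nonneg_left (maxQf_div_le hs h) (Real.sqrt_nonneg _)).trans ?_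
    rw [← mul_assoc, ← Real.sqrt_mul (by positivity), div_mul_div_cancel₀ hs₀.ne', div_self hs.ne',
      Real.sqrt_one, one_mul]
  · simp [hs.ne']
  · refine (mul_le_mul_of_nonneg_right (min_le_left _ _) (hF _ hs₀).le).trans ?_
    rw [one_mul]
    exact (maxQf_div_lt hs₀ h).le
  · refine le_trans ?_ (mul_le_mul_of_nonneg_right (le_max_left _ _) (hF _ hs₀).le)
    rw [one_mul]
    exact (maxQf_div_lt hs h).le
  · simp [hs.ne']
  · exact (maxQf_div_le hs₀ h).trans
      (mul_le_mul_of_nonneg_right (le_max_right _ _) (hF _ hs₀).le)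

theorem tendsto_maxQf_div_zero : Tendsto (fun s => maxQf s / s) (𝓝[>] 0) (𝓝 1) := by
  refine tendsto_order.2 ⟨fun a ha => ?_, fun b hb => ?_⟩
  · filter_upwards [self_mem_nhdsWithin] with s hs
    exact ha.trans ((one_lt_div hs).2 (lt_maxQf hs))
  · obtain ⟨c, hc1, hc2⟩ := exists_between hb
    filter_upwards [self_mem_nhdsWithin, eventually_maxQf_le hc1] with s hs h
    exact ((div_le_iff₀ hs).2 h).trans_lt hc2

theorem tendsto_maxQf_div_atTop : Tendsto (fun s => maxQf s / s) atTop (𝓝 maxRatio) := by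
  have h : Tendsto (fun s : ℝ => maxRatio - 3 * Real.pi * B ^ 2 / s) atTop (𝓝 (maxRatio - 0)) :=
    tendsto_const_nhds.sub (tendsto_const_nhds.div_atTop tendsto_id)
  rw [sub_zero] at h
  refine tendsto_of_tendsto_of_tendsto_of_le_of_le' h tendsto_const_nhds ?_ ?_
  · filter_upwards [eventually_gt_atTop 0] with s hs
    have h1 := le_maxQf_of_indicator hs (by linarith [B_mem.1] : 0 < B)
    rw [← maxRatio_eq] at h1
    rw [le_div_iff₀ hs, sub_mul, div_mul_cancel₀ _ hs.ne']
    exact h1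
  · filter_upwards [eventually_gt_atTop 0] with s hs
    exact (div_le_iff₀ hs).2 (maxQf_le_maxRatio_mul hs.le)

end

end Whitham

/-! ### Return to α through the decreasing substitution s = α⁻³ -/

open Whitham in
theorem mainTheorem5 :
    ContinuousOn (fun α : ℝ => α * Whitham.J α ^ 2) (Set.Ioi 0) ∧
    StrictAntiOn (fun α : ℝ => α * Whitham.J α ^ 2) (Set.Ioi 0) ∧
    Filter.Tendsto (fun α : ℝ => α * Whitham.J α ^ 2) Filter.atTop (nhds 1) ∧
    Filter.Tendsto (fun α : ℝ => α * Whitham.J α ^ 2) (nhdsWithin 0 (Set.Ioi 0))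
      (nhds (3 * Whitham.B ^ 2 / (2 + 3 * (Whitham.B - 1) + 3 * (Whitham.B - 1) ^ 3))) ∧
    3 / 2 < 3 * Whitham.B ^ 2 / (2 + 3 * (Whitham.B - 1) + 3 * (Whitham.B - 1) ^ 3) ∧
    |Whitham.B - 1.48| < 0.005 := by
  have hpos : ∀ α ∈ Ioi (0 : ℝ), 0 < (α ^ 3)⁻¹ := fun α hα => inv_pos.2 (pow_pos (mem_Ioi.1 hα) 3)
  have hinv0 : Tendsto (fun α : ℝ => (α ^ 3)⁻¹) atTop (𝓝[>] 0) :=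
    tendsto_inv_atTop_nhdsGT_zero.comp (tendsto_pow_atTop (by norm_num))
  have hinvT : Tendsto (fun α : ℝ => (α ^ 3)⁻¹) (𝓝[>] 0) atTop := by
    refine tendsto_inv_nhdsGT_zero.comp (tendsto_nhdsWithin_iff.2 ⟨?_, ?_⟩)
    · have h := ((continuous_pow 3).tendsto (0 : ℝ)).mono_left (nhdsWithin_le_nhds (s := Ioi 0))
      simpa using h
    · filter_upwards [self_mem_nhdsWithin] with α hα
      exact pow_pos (mem_Ioi.1 hα) 3
  refine ⟨?_, fun a ha b hb hab => ?_, ?_, ?_, lt_maxRatio, ?_⟩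
  · refine (continuousOn_maxQf_div.comp (f := fun α : ℝ => (α ^ 3)⁻¹) ?_ hpos).congr
      fun α hα => mul_J_sq hα
    exact (continuous_pow 3).continuousOn.inv₀ fun α hα => (pow_pos (mem_Ioi.1 hα) 3).ne'
  · have ha' : 0 < a := ha
    simp only [mul_J_sq ha, mul_J_sq hb]
    exact maxQf_div_lt (hpos b hb) (by gcongr)
  · refine (tendsto_maxQf_div_zero.comp hinv0).congr' ?_
    filter_upwards [eventually_gt_atTop 0] with α hα
    exact (mul_J_sq hα).symm
  · refine (tendsto_maxQf_div_atTop.comp hinvT).congr' ?_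
    filter_upwards [self_mem_nhdsWithin] with α hα
    exact (mul_J_sq hα).symm
  · have h := B_mem
    rw [abs_lt]
    constructor <;> linarith [h.1, h.2]
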